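/- All systems $A,B,\dots$ are finite-dimensional nonzero complex Hilbert spaces, $|A|$ is the dimension of $A$, $\mathrm{CPTP}(A\to B)$ is the set of quantum channels (completely positive trace-preserving linear maps) from operators on $A$ to operators on $B$, and $\log=\log_2$. The uniform channel is $\mathcal R=\mathcal R^{A\to B}:X\mapsto \mathrm{Tr}[X]\,I_B/|B|$. A superchannel $\Theta$ is a linear map on superoperators of the form $\Theta[\mathcal N^{A\to B}]=\mathcal E^{RB\to B}\circ(\mathsf{id}_R\otimes\mathcal N^{A\to B})\circ\mathcal V^{A'\to RA}$ with an auxiliary system $R$, an isometry channel $\mathcal V$ and a channel $\mathcal E$; it is in standard form if $|R|$ is minimal among all such representations of $\Theta$. $\Theta$ is mixing if, in standard form, $\mathcal E$ is conditionally unital, i.e. $\omega\mapsto\mathcal E(\tau^R\otimes\omega)$ is unital for every density matrix $\tau$ on $R$. For $\mathcal N\in\mathrm{CPTP}(A\to B)$ and $\mathcal M\in\mathrm{CPTP}(A'\to B)$, $\mathcal N\succ\mathcal M$ means that $\mathcal M=\Theta[\mathcal N]$ for some mixing superchannel $\Theta$. For $\mathcal M\in\mathrm{CPTP}(A'\to B')$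 in general, $\mathcal N\succ\mathcal M$ means: if $|B|>|B'|$, that $\mathcal N\succ\mathcal U\circ\mathcal M$ for some isometry channel $\mathcal U^{B'\to B}$; if $|B|\le|B'|$, that $\mathcal V\circ\mathcal N\succ\mathcal M$ for some isometry channel $\mathcal V^{B\to B'}$. A channel entropy is a function $\mathbb H$, not identically zero, that assigns a real number $\mathbb H(B|A)_{\mathcal N}$ to every channel $\mathcal N\in\mathrm{CPTP}(A\to B)$, for all systems $A,B$, such that (1) $\mathcal N^{A\to B}\succ\mathcal M^{A'\to B'}$ implies $\mathbb H(B|A)_{\mathcal N}\le\mathbb H(B'|A')_{\mathcal M}$, and (2) $\mathbb H(BB'|AA')_{\mathcal N\otimes\mathcal M}=\mathbb H(B|A)_{\mathcal N}+\mathbb H(B'|A')_{\mathcal M}$. It is normalized if the uniform qubit state (as a channel with one-dimensional input) has entropy $1$. The min-entropy of a channel is $$H_{\min}(B|A)_{\mathcal N}=\log|B|-D_{\max}(\mathcal N\|\mathcal R),\qquad D_{\max}(\mathcal N\|\mathcal R)=\min\{\log t: t>0,\ t\mathcal R-\mathcal N\text{ is completely positive}\}.$$ **Theorem.** Every normalized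 channel entropy $\mathbb H$ satisfies $$\mathbb H(B|A)_{\mathcal N}\ \ge\ H_{\min}(B|A)_{\mathcal N}$$ for all systems $A,B$ and all $\mathcal N\in\mathrm{CPTP}(A\to B)$. Moreover $H_{\min}$ is itself a normalized channel entropy; thus it is the smallest normalized channel entropy. -/

import Mathlib

open scoped Kronecker ComplexOrder

noncomputable section

namespace QChannel

/-!
Finite-dimensional quantum systems are represented by finite nonempty types `A`, `B`, … (an
orthonormal basis of the underlying Hilbert space), operators on `A` by complex matrices indexed by
`A`, and the composite of two systems by the product type.
-/

/-- Superoperators from system `A` to system `B`: complex linear maps on matrices. -/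
abbrev Superop (A B : Type) : Type := Matrix A A ℂ →ₗ[ℂ] Matrix B B ℂ

/-- `id ⊗ Φ`, with the reference system `K` on the left: `Φ` is applied to each block. -/
def lTensor (K : Type) {A B : Type} (Φ : Superop A B) : Superop (K × A) (K × B) where
  toFun X := Matrix.of fun p q => Φ (Matrix.of fun a a' => X (p.1, a) (q.1, a')) p.2 q.2
  map_add' X Y := by
    ext p q
    exact congrFun (congrFun (map_add Φ (Matrix.of fun a a' => X (p.1, a) (q.1, a'))
      (Matrix.of fun a a' => Y (p.1, a) (q.1, a'))) p.2) q.2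
  map_smul' c X := by
    ext p q
    exact congrFun (congrFun (map_smul Φ c (Matrix.of fun a a' => X (p.1, a) (q.1, a'))) p.2) q.2

/-- `Φ ⊗ id`, with the reference system `K` on the right. -/
def rTensor (K : Type) {A B : Type} (Φ : Superop A B) : Superop (A × K) (B × K) where
  toFun X := Matrix.of fun p q => Φ (Matrix.of fun a a' => X (a, p.2) (a', q.2)) p.1 q.1
  map_add' X Y := by
    ext p q
    exact congrFun (congrFun (map_add Φ (Matrix.of fun a a' => X (a, p.2) (a', q.2))
      (Matrix.of fun a a' => Y (a, p.2) (a', q.2))) p.1) q.1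
  map_smul' c X := by
    ext p q
    exact congrFun (congrFun (map_smul Φ c (Matrix.of fun a a' => X (a, p.2) (a', q.2))) p.1) q.1

/-- The tensor product `Φ ⊗ Ψ = (Φ ⊗ id) ∘ (id ⊗ Ψ)` of two superoperators. -/
def tensor {A B A' B' : Type} (Φ : Superop A B) (Ψ : Superop A' B') :
    Superop (A × A') (B × B') :=
  rTensor B' Φ ∘ₗ lTensor A Ψ

/-- The tensor product acts on product operators as expected. -/
theorem tensor_kronecker {A B A' B' : Type} (Φ : Superop A B) (Ψ : Superop A' B')
    (X : Matrix A A ℂ) (Y : Matrix A' A' ℂ) : tensor Φ Ψ (X ⊗ₖ Y) = Φ X ⊗ₖ Ψ Y := by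
  have h1 : lTensor A Ψ (X ⊗ₖ Y) = X ⊗ₖ Ψ Y := by
    ext p q
    exact congrFun (congrFun (map_smul Ψ (X p.1 q.1) Y) p.2) q.2
  have h2 : rTensor B' Φ (X ⊗ₖ Ψ Y) = Φ X ⊗ₖ Ψ Y := by
    ext p q
    have h3 : (Matrix.of fun a a' => X a a' * Ψ Y p.2 q.2) = (Ψ Y p.2 q.2) • X := by
      ext a a'
      simp [mul_comm]
    simp [rTensor, h3, mul_comm]
  simp [tensor, h1, h2]

/-- Complete positivity: `id ⊗ Φ` preserves positive semidefiniteness for every finite reference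
system `K`. -/
def IsCP {A B : Type} (Φ : Superop A B) : Prop :=
  ∀ (K : Type) [Finite K] (X : Matrix (K × A) (K × A) ℂ),
    X.PosSemidef → (lTensor K Φ X).PosSemidef

/-- Trace preservation. -/
def IsTP {A B : Type} [Fintype A] [Fintype B] (Φ : Superop A B) : Prop :=
  ∀ X, (Φ X).trace = X.trace

/-- Quantum channels, CPTP(A → B). -/
def Channel (A B : Type) [Fintype A] [Fintype B] : Type :=
  {Φ : Superop A B // IsCP Φ ∧ IsTP Φ}

theorem isCP_lTensor {A B : Type} (L : Type) [Finite L] {Φ : Superop A B} (h : IsCP Φ) :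
    IsCP (lTensor L Φ) := by
  intro K _ X hX
  have h1 := h (K × L) _ (hX.submatrix (fun p : (K × L) × A => (p.1.1, (p.1.2, p.2))))
  exact h1.submatrix (fun p : K × (L × B) => ((p.1, p.2.1), p.2.2))

theorem isCP_rTensor {A B : Type} (L : Type) [Finite L] {Φ : Superop A B} (h : IsCP Φ) :
    IsCP (rTensor L Φ) := by
  intro K _ X hX
  have h1 := h (K × L) _ (hX.submatrix (fun p : (K × L) × A => (p.1.1, (p.2, p.1.2))))
  exact h1.submatrix (fun p : K × (B × L) => ((p.1, p.2.2), p.2.1))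

theorem isCP_comp {A B C : Type} {Φ : Superop B C} {Ψ : Superop A B} (h : IsCP Φ) (h' : IsCP Ψ) :
    IsCP (Φ ∘ₗ Ψ) := fun K _ X hX => h K _ (h' K X hX)

theorem isTP_lTensor {A B : Type} [Fintype A] [Fintype B] (L : Type) [Fintype L]
    {Φ : Superop A B} (h : IsTP Φ) : IsTP (lTensor L Φ) := by
  intro X
  simp only [Matrix.trace, Fintype.sum_prod_type]
  exact Finset.sum_congr rfl fun l _ => h (Matrix.of fun a a' => X (l, a) (l, a'))

theorem isTP_rTensor {A B : Type} [Fintype A] [Fintype B] (L : Type) [Fintype L]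
    {Φ : Superop A B} (h : IsTP Φ) : IsTP (rTensor L Φ) := by
  intro X
  simp only [Matrix.trace, Fintype.sum_prod_type_right]
  exact Finset.sum_congr rfl fun l _ => h (Matrix.of fun a a' => X (a, l) (a', l))

/-- The tensor product `𝒩 ⊗ ℳ` of two channels. -/
def Channel.tensor {A B A' B' : Type} [Fintype A] [Fintype B] [Fintype A'] [Fintype B']
    (N : Channel A B) (M : Channel A' B') : Channel (A × A') (B × B') :=
  ⟨QChannel.tensor N.1 M.1,
    isCP_comp (isCP_rTensor B' N.2.1) (isCP_lTensor A M.2.1),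
    fun X => (isTP_rTensor B' N.2.2 _).trans (isTP_lTensor A M.2.2 X)⟩

/-- The map `X ↦ Tr[X] · 1/|B|`. -/
def uniformSuperop (A B : Type) [Fintype A] [Fintype B] [DecidableEq B] : Superop A B where
  toFun X := (X.trace / (Fintype.card B : ℂ)) • (1 : Matrix B B ℂ)
  map_add' X Y := by simp [add_div, add_smul]
  map_smul' c X := by simp [mul_div_assoc, smul_smul]

theorem isCP_uniformSuperop (A B : Type) [Fintype A] [Fintype B] [DecidableEq B] :
    IsCP (uniformSuperop A B) := by
  classical
  intro K _ X hX
  have := Fintype.ofFinite K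
  have h1 : (∑ a : A, X.submatrix (fun k : K => (k, a)) (fun k : K => (k, a))).PosSemidef :=
    Matrix.posSemidef_sum _ fun a _ => hX.submatrix _
  have h2 : ((1 / (Fintype.card B : ℂ)) • (1 : Matrix B B ℂ)).PosSemidef :=
    Matrix.PosSemidef.one.smul (by positivity)
  suffices e : lTensor K (uniformSuperop A B) X = (∑ a : A, X.submatrix (fun k : K => (k, a))
      (fun k : K => (k, a))) ⊗ₖ ((1 / (Fintype.card B : ℂ)) • (1 : Matrix B B ℂ)) by
    rw [e]
    exact h1.kronecker h2
  ext p q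
  simp [lTensor, uniformSuperop, Matrix.kroneckerMap_apply, Matrix.trace, Matrix.sum_apply,
    div_eq_mul_inv, mul_assoc]

/-- The uniform (completely randomizing) channel `ℛ^{A → B}`, which outputs the maximally mixed
state of `B` for every input state. For a one-dimensional `A` it is the uniform state of `B`. -/
def uniformChannel (A B : Type) [Fintype A] [Fintype B] [DecidableEq B] [Nonempty B] :
    Channel A B :=
  ⟨uniformSuperop A B, isCP_uniformSuperop A B, fun X => by
    simp [uniformSuperop, Matrix.trace_smul, Matrix.trace_one]⟩

/-- Conjugation `X ↦ V X Vᴴ`; an isometry channel if `Vᴴ V = 1`. -/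
def conjBy {A B : Type} [Fintype A] (V : Matrix B A ℂ) : Superop A B where
  toFun X := V * X * V.conjTranspose
  map_add' X Y := by rw [Matrix.mul_add, Matrix.add_mul]
  map_smul' c X := by simp

/-- `V` is (the matrix of) an isometry. -/
def IsIsometry {A B : Type} [DecidableEq A] [Fintype B] (V : Matrix B A ℂ) : Prop :=
  V.conjTranspose * V = 1

/-- Density matrices (states) of the system `R`. -/
def IsState {R : Type} [Fintype R] (τ : Matrix R R ℂ) : Prop :=
  τ.PosSemidef ∧ τ.trace = 1

/-- A channel `E` from `RB` to `B` is conditionally unital if for every state `τ` of `R` the channel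
`ω ↦ E (τ ⊗ ω)` is unital, hence doubly stochastic. -/
def IsConditionallyUnital {R B : Type} [Fintype R] [DecidableEq B] (E : Superop (R × B) B) : Prop :=
  ∀ τ : Matrix R R ℂ, IsState τ → E (τ ⊗ₖ (1 : Matrix B B ℂ)) = 1

/-- The supermap `Θ` is the superchannel implemented by the auxiliary system `R`, the pre-processing
isometry `V : A' → RA` and the post-processing channel `E : RB → B`, that is,
`Θ[𝒩] = E ∘ (id_R ⊗ 𝒩) ∘ (V · Vᴴ)`. -/
structure IsRealization {A A' B : Type} [Fintype A] [Fintype A'] [DecidableEq A'] [Fintype B]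
    (Θ : Superop A B →ₗ[ℂ] Superop A' B) (R : Type) [Fintype R]
    (V : Matrix (R × A) A' ℂ) (E : Superop (R × B) B) : Prop where
  isometry : IsIsometry V
  channel : IsCP E ∧ IsTP E
  action : ∀ N : Superop A B, Θ N = E ∘ₗ lTensor R N ∘ₗ conjBy V

/-- A realization is in standard form if its auxiliary system has the least possible dimension. -/
structure IsStandardForm {A A' B : Type} [Fintype A] [Fintype A'] [DecidableEq A'] [Fintype B]
    (Θ : Superop A B →ₗ[ℂ] Superop A' B) (R : Type) [Fintype R]
    (V : Matrix (R × A) A' ℂ) (E : Superop (R × B) B) : Prop where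
  realization : IsRealization Θ R V E
  minimal : ∀ (R' : Type) [Fintype R'] (V' : Matrix (R' × A) A' ℂ) (E' : Superop (R' × B) B),
    IsRealization Θ R' V' E' → Fintype.card R ≤ Fintype.card R'

/-- Mixing superchannels: in standard form the post-processing is conditionally unital. -/
def IsMixing {A A' B : Type} [Fintype A] [Fintype A'] [DecidableEq A'] [Fintype B] [DecidableEq B]
    (Θ : Superop A B →ₗ[ℂ] Superop A' B) : Prop :=
  ∃ (R : Type) (_ : Fintype R) (V : Matrix (R × A) A' ℂ) (E : Superop (R × B) B),
    IsStandardForm Θ R V E ∧ IsConditionallyUnital E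

/-- Channel majorization for two channels with the same output system. -/
def MajorizesSame {A A' B : Type} [Fintype A] [Fintype A'] [DecidableEq A'] [Fintype B]
    [DecidableEq B] (N : Superop A B) (M : Superop A' B) : Prop :=
  ∃ Θ : Superop A B →ₗ[ℂ] Superop A' B, IsMixing Θ ∧ M = Θ N

/-- Channel majorization `𝒩 ≻ ℳ` for arbitrary output systems: the smaller output system is embedded
in the larger one by an isometry. -/
def Majorizes {A B A' B' : Type} [Fintype A] [Fintype B] [DecidableEq B]
    [Fintype A'] [DecidableEq A'] [Fintype B'] [DecidableEq B']
    (N : Channel A B) (M : Channel A' B') : Prop :=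
  (Fintype.card B' < Fintype.card B ∧
    ∃ U : Matrix B B' ℂ, IsIsometry U ∧ MajorizesSame N.1 (conjBy U ∘ₗ M.1)) ∨
  (Fintype.card B ≤ Fintype.card B' ∧
    ∃ V : Matrix B' B ℂ, IsIsometry V ∧ MajorizesSame (conjBy V ∘ₗ N.1) M.1)

/-- Real-valued functions on all channels between finite-dimensional systems. -/
abbrev ChannelFunction : Type 1 :=
  ∀ (A B : Type) [Fintype A] [DecidableEq A] [Nonempty A] [Fintype B] [DecidableEq B] [Nonempty B],
    Channel A B → ℝ

/-- Channel entropies: functions on channels that are not identically zero, monotone under channel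
majorization and additive under tensor products. -/
structure IsChannelEntropy (H : ChannelFunction) : Prop where
  nonzero : ∃ (A B : Type) (_ : Fintype A) (_ : DecidableEq A) (_ : Nonempty A)
    (_ : Fintype B) (_ : DecidableEq B) (_ : Nonempty B) (N : Channel A B), H A B N ≠ 0
  monotone : ∀ (A B A' B' : Type) [Fintype A] [DecidableEq A] [Nonempty A]
    [Fintype B] [DecidableEq B] [Nonempty B] [Fintype A'] [DecidableEq A'] [Nonempty A']
    [Fintype B'] [DecidableEq B'] [Nonempty B'] (N : Channel A B) (M : Channel A' B'),
    Majorizes N M → H A B N ≤ H A' B' M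
  additive : ∀ (A B A' B' : Type) [Fintype A] [DecidableEq A] [Nonempty A]
    [Fintype B] [DecidableEq B] [Nonempty B] [Fintype A'] [DecidableEq A'] [Nonempty A']
    [Fintype B'] [DecidableEq B'] [Nonempty B'] (N : Channel A B) (M : Channel A' B'),
    H (A × A') (B × B') (N.tensor M) = H A B N + H A' B' M

/-- Normalization: the uniform qubit state has unit entropy. -/
def IsNormalized (H : ChannelFunction) : Prop :=
  H Unit (Fin 2) (uniformChannel Unit (Fin 2)) = 1

/-- The numbers `log₂ t` with `t ℳ ≥ 𝒩` in the order given by the cone of completely positive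
maps. -/
def dmaxSet {A B : Type} [Fintype A] [Fintype B] (N M : Channel A B) : Set ℝ :=
  {x | ∃ t : ℝ, 0 < t ∧ IsCP ((t : ℂ) • M.1 - N.1) ∧ x = Real.logb 2 t}

/-- The max-relative entropy `D_max(𝒩‖ℳ) = min {log₂ t : t ℳ ≥ 𝒩}` of channels, for pairs for
which such a `t` exists; for the uniform channel `ℳ = ℛ` see `isLeast_dmax_uniform`. -/
def dmax {A B : Type} [Fintype A] [Fintype B] (N M : Channel A B) : ℝ :=
  sInf (dmaxSet N M)

theorem posSemidef_partialTrace_sub {K B : Type} [Finite K] [Fintype B] [DecidableEq B]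
    {Y : Matrix (K × B) (K × B) ℂ} (hY : Y.PosSemidef) :
    (Matrix.of fun p q : K × B =>
      (Fintype.card B : ℂ) * (if p.2 = q.2 then ∑ b, Y (p.1, b) (q.1, b) else 0)
        - Y p q).PosSemidef := by
  classical
  have := Fintype.ofFinite K
  have h1 : ∀ d : K × B → ℝ, (Matrix.of fun p q => (d p : ℂ) * Y p q * (d q : ℂ)).PosSemidef := by
    intro d
    have h := hY.mul_mul_conjTranspose_same (Matrix.diagonal fun p => (d p : ℂ))
    convert h using 1
    ext p q
    simp [Matrix.diagonal_conjTranspose, Matrix.mul_diagonal, Matrix.diagonal_mul]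
  have h2 : ∀ (b : B) (d : K × B → ℝ),
      (Matrix.of fun p q => (d p : ℂ) * Y (p.1, b) (q.1, b) * (d q : ℂ)).PosSemidef := by
    intro b d
    have h := (hY.submatrix (fun p : K × B => (p.1, b))).mul_mul_conjTranspose_same
      (Matrix.diagonal fun p => (d p : ℂ))
    convert h using 1
    ext p q
    simp [Matrix.diagonal_conjTranspose, Matrix.mul_diagonal, Matrix.diagonal_mul]
  have h3 := Matrix.posSemidef_sum (Finset.univ : Finset (B × B)) fun i _ =>
    h1 fun p => (if p.2 = i.1 then 1 else 0) - (if p.2 = i.2 then 1 else 0)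
  have h4 := Matrix.posSemidef_sum ((Finset.univ : Finset (B × B)).filter fun i => i.1 ≠ i.2)
    fun i _ => h2 i.1 fun p => if p.2 = i.2 then 1 else 0
  have h5 := (h3.smul (show (0 : ℝ) ≤ 1 / 2 by norm_num)).add
    (h4.smul (show (0 : ℝ) ≤ Fintype.card B by positivity))
  convert h5 using 1
  ext p q
  simp only [Matrix.of_apply, Matrix.add_apply, Matrix.smul_apply, Matrix.sum_apply,
    Complex.real_smul]
  have e0 : ∀ (a c : B → ℂ) (y : ℂ), ∑ i : B × B, (a i.1 - a i.2) * y * (c i.1 - c i.2)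
      = 2 * (Fintype.card B * (∑ b, a b * c b) - (∑ b, a b) * ∑ b, c b) * y := by
    intro a c y
    have e (i j : B) : (a i - a j) * y * (c i - c j)
        = (a i * c i - a i * c j - a j * c i + a j * c j) * y := by ring
    simp only [Fintype.sum_prod_type, e, ← Finset.sum_mul, Finset.sum_add_distrib,
      Finset.sum_sub_distrib, ← Finset.mul_sum, Finset.sum_const, Finset.card_univ, nsmul_eq_mul,
      mul_assoc]
    ring
  have e1 := e0 (fun b => if p.2 = b then 1 else 0) (fun b => if q.2 = b then 1 else 0) (Y p q)
  have e2 : ∑ i ∈ (Finset.univ : Finset (B × B)).filter (fun i => i.1 ≠ i.2),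
      (if p.2 = i.2 then (1 : ℂ) else 0) * Y (p.1, i.1) (q.1, i.1)
        * (if q.2 = i.2 then (1 : ℂ) else 0)
      = if p.2 = q.2 then ∑ b, Y (p.1, b) (q.1, b) - Y p q else 0 := by
    rw [Finset.sum_filter, Fintype.sum_prod_type, Finset.sum_comm,
      Finset.sum_eq_single_of_mem p.2 (Finset.mem_univ _) (by
        intro b _ hb
        simp [hb.symm])]
    split_ifs with hpq
    · have e3 : (Finset.univ : Finset B).sum (fun b => Y (p.1, b) (q.1, b)) - Y p q
          = ∑ b, (Y (p.1, b) (q.1, b) - if b = p.2 then Y p q else 0) := by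
        simp [Finset.sum_sub_distrib]
      rw [e3]
      refine Finset.sum_congr rfl fun b _ => ?_
      by_cases hb : b = p.2
      · subst hb
        have : Y (p.1, p.2) (q.1, p.2) = Y p q := by rw [Prod.mk.eta, hpq, Prod.mk.eta]
        simp [this]
      · simp [hb, hpq.symm]
    · simp [Ne.symm hpq]
  have e4 : ∑ b, (if p.2 = b then (1 : ℂ) else 0) * (if q.2 = b then 1 else 0)
      = if p.2 = q.2 then 1 else 0 := by simp [eq_comm]
  simp only [Complex.ofReal_sub, apply_ite Complex.ofReal, Complex.ofReal_one, Complex.ofReal_zero]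
  rw [e1, e2, e4]
  simp only [Finset.sum_ite_eq, Finset.mem_univ, if_true]
  split_ifs
  · push_cast
    ring
  · push_cast
    ring

theorem isCP_smul_uniform_sub {A B : Type} [Fintype A] [Fintype B] [DecidableEq B] [Nonempty B]
    (N : Channel A B) :
    IsCP ((((Fintype.card B : ℝ) ^ 2 : ℝ) : ℂ) • (uniformChannel A B).1 - N.1) := by
  intro K _ X hX
  have h := posSemidef_partialTrace_sub (N.2.1 K X hX)
  convert h using 1
  ext p q
  have h1 : ∑ b, lTensor K N.1 X (p.1, b) (q.1, b)
      = Matrix.trace (Matrix.of fun a a' => X (p.1, a) (q.1, a')) :=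
    N.2.2 (Matrix.of fun a a' => X (p.1, a) (q.1, a'))
  have h0 : (Fintype.card B : ℂ) ≠ 0 := by simp
  rw [Matrix.of_apply, h1]
  simp only [lTensor, uniformChannel, uniformSuperop, LinearMap.coe_mk, AddHom.coe_mk,
    Matrix.of_apply, LinearMap.sub_apply, LinearMap.smul_apply, Matrix.sub_apply, Matrix.smul_apply,
    Matrix.one_apply, smul_eq_mul]
  push_cast
  split_ifs
  · field_simp
  · simp

theorem one_le_of_isCP {A B : Type} [Fintype A] [Nonempty A] [Fintype B] [DecidableEq B]
    [Nonempty B] (N : Channel A B) {t : ℝ}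
    (h : IsCP ((t : ℂ) • (uniformChannel A B).1 - N.1)) : 1 ≤ t := by
  classical
  have h1 := (h Unit (1 : Matrix (Unit × A) (Unit × A) ℂ) Matrix.PosSemidef.one).trace_nonneg
  have h2 : (Matrix.of fun a a' => (1 : Matrix (Unit × A) (Unit × A) ℂ) ((), a) ((), a'))
      = (1 : Matrix A A ℂ) := by
    ext a a'
    simp [Matrix.one_apply]
  have h3 : (lTensor Unit ((t : ℂ) • (uniformChannel A B).1 - N.1)
      (1 : Matrix (Unit × A) (Unit × A) ℂ)).trace
      = (((t : ℂ) • (uniformChannel A B).1 - N.1) (1 : Matrix A A ℂ)).trace := by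
    rw [← h2, Matrix.trace, Fintype.sum_prod_type]
    simp [Matrix.trace, lTensor]
  have h4 : (((t : ℂ) • (uniformChannel A B).1 - N.1) (1 : Matrix A A ℂ)).trace
      = (((t - 1) * Fintype.card A : ℝ) : ℂ) := by
    have e1 := (uniformChannel A B).2.2 (1 : Matrix A A ℂ)
    have e2 := N.2.2 (1 : Matrix A A ℂ)
    simp only [LinearMap.sub_apply, LinearMap.smul_apply, Matrix.trace_sub, Matrix.trace_smul,
      e1, e2, Matrix.trace_one, smul_eq_mul]
    push_cast
    ring
  rw [h3, h4, Complex.zero_le_real] at h1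
  have h5 : (0 : ℝ) < Fintype.card A := by exact_mod_cast Fintype.card_pos
  nlinarith [nonneg_of_mul_nonneg_left h1 h5]

theorem isClosed_isCP {A B : Type} [Finite B] (Φ Ψ : Superop A B) (h : IsCP Φ) (h' : IsCP Ψ) :
    IsClosed {t : ℝ | IsCP ((t : ℂ) • Φ - Ψ)} := by
  have := Fintype.ofFinite B
  have e : {t : ℝ | IsCP ((t : ℂ) • Φ - Ψ)} = ⋂ (K : Type), ⋂ (_ : Finite K),
      ⋂ (X : Matrix (K × A) (K × A) ℂ), ⋂ (_ : X.PosSemidef),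
        {t : ℝ | (lTensor K ((t : ℂ) • Φ - Ψ) X).PosSemidef} := by
    ext t
    simp [IsCP]
  rw [e]
  refine isClosed_iInter fun K => isClosed_iInter fun _ => isClosed_iInter fun X =>
    isClosed_iInter fun hX => ?_
  have := Fintype.ofFinite K
  have e1 : ∀ t : ℝ, lTensor K ((t : ℂ) • Φ - Ψ) X = (t : ℂ) • lTensor K Φ X - lTensor K Ψ X :=
    fun t => rfl
  have e2 : ∀ t : ℝ, ((t : ℂ) • lTensor K Φ X - lTensor K Ψ X).IsHermitian := fun t =>
    ((h K X hX).1.smul (by simp [IsSelfAdjoint])).sub (h' K X hX).1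
  simp only [e1, Matrix.posSemidef_iff_dotProduct_mulVec, e2, true_and, Set.ofPred_forall]
  refine isClosed_iInter fun x => ?_
  simp only [Matrix.sub_mulVec, Matrix.smul_mulVec, dotProduct_sub, dotProduct_smul]
  exact isClosed_le continuous_const (by fun_prop)

/-- The minimum that defines `D_max(𝒩‖ℛ)` is attained. -/
theorem isLeast_dmax_uniform {A B : Type} [Fintype A] [Nonempty A] [Fintype B] [DecidableEq B]
    [Nonempty B] (N : Channel A B) :
    IsLeast (dmaxSet N (uniformChannel A B)) (dmax N (uniformChannel A B)) := by
  set S : Set ℝ := {t : ℝ | IsCP ((t : ℂ) • (uniformChannel A B).1 - N.1)} with hS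
  have hb : BddBelow S := ⟨1, fun t ht => one_le_of_isCP N ht⟩
  have hm : sInf S ∈ S :=
    (isClosed_isCP _ _ (uniformChannel A B).2.1 N.2.1).csInf_mem ⟨_, isCP_smul_uniform_sub N⟩ hb
  have hl : IsLeast (dmaxSet N (uniformChannel A B)) (Real.logb 2 (sInf S)) := by
    refine ⟨⟨sInf S, lt_of_lt_of_le one_pos (one_le_of_isCP N hm), hm, rfl⟩, ?_⟩
    rintro x ⟨t, ht, hcp, rfl⟩
    exact Real.logb_le_logb_of_le one_lt_two (lt_of_lt_of_le one_pos (one_le_of_isCP N hm))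
      (csInf_le hb hcp)
  rw [dmax, hl.csInf_eq]
  exact hl

/-- The min-entropy of a channel, `H_min(B|A)_𝒩 = log₂ |B| - D_max(𝒩‖ℛ)`. -/
def channelMinEntropy : ChannelFunction := fun A B _ _ _ _ _ _ N =>
  Real.logb 2 (Fintype.card B) - dmax N (uniformChannel A B)

end QChannel

end

/-!
The number `2 ^ (-H_min)` of a channel `N` is the least `s` with `N ≤ s Tr[·] 1` in the order of
completely positive maps. A mixing superchannel is completely positive and maps `Tr[·] 1` to
`Tr[·] 1`, so it can only lower this `s`: the min-entropy is monotone. It is additive because an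
inequality between tensor products is an inequality between products of quadratic forms, which
separates into two inequalities of ratios.

Conversely, if `k N ≤ Tr[·] 1`, then `N` is obtained from the uniform state of dimension `k` by a
mixing superchannel that measures the state and prepares the output accordingly. A normalized
channel entropy has the value `n` at the uniform state of dimension `2 ^ n`, so it is at least the
min-entropy rounded down, and the rounding error disappears on tensor powers.
-/

noncomputable section

namespace QChannel

open scoped Matrix

variable {A A' B B' C : Type}

/-! ### The order of completely positive maps -/

theorem isCP_zero : IsCP (0 : Superop A B) := fun _ _ _ _ => Matrix.PosSemidef.zero

theorem IsCP.add {Φ Ψ : Superop A B} (hΦ : IsCP Φ) (hΨ : IsCP Ψ) : IsCP (Φ + Ψ) :=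
  fun K _ X hX => (hΦ K X hX).add (hΨ K X hX)

theorem IsCP.smul {Φ : Superop A B} (hΦ : IsCP Φ) {c : ℂ} (hc : 0 ≤ c) : IsCP (c • Φ) :=
  fun K _ X hX => (hΦ K X hX).smul hc

theorem IsCP.sum {ι : Type*} {s : Finset ι} {Φ : ι → Superop A B} (hΦ : ∀ i ∈ s, IsCP (Φ i)) :
    IsCP (∑ i ∈ s, Φ i) :=
  Finset.sum_induction Φ IsCP (fun _ _ => IsCP.add) isCP_zero hΦ

theorem IsCP.tensor [Finite A] [Finite B'] {Φ : Superop A B} {Ψ : Superop A' B'} (hΦ : IsCP Φ)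
    (hΨ : IsCP Ψ) : IsCP (tensor Φ Ψ) :=
  isCP_comp (isCP_rTensor B' hΦ) (isCP_lTensor A hΨ)

theorem IsCP.posSemidef {Φ : Superop A B} (hΦ : IsCP Φ) {X : Matrix A A ℂ} (hX : X.PosSemidef) :
    (Φ X).PosSemidef :=
  (hΦ Unit _ (hX.submatrix Prod.snd)).submatrix (Prod.mk ())

theorem isCP_conjBy [Fintype A] [Finite B] (V : Matrix B A ℂ) : IsCP (conjBy V) := by
  classical
  intro K _ X hX
  have := Fintype.ofFinite K
  have := Fintype.ofFinite B
  convert hX.mul_mul_conjTranspose_same ((1 : Matrix K K ℂ) ⊗ₖ V) using 1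
  ext p q
  simp [lTensor, conjBy, Matrix.mul_apply, Fintype.sum_prod_type, Matrix.one_apply, apply_ite]

/-- The order `Φ ≤ Ψ` on superoperators given by the cone of completely positive maps. -/
def CPLe (Φ Ψ : Superop A B) : Prop := IsCP (Ψ - Φ)

theorem CPLe.refl (Φ : Superop A B) : CPLe Φ Φ := by
  rw [CPLe, sub_self]
  exact isCP_zero

theorem CPLe.trans {Φ Ψ Ω : Superop A B} (h₁ : CPLe Φ Ψ) (h₂ : CPLe Ψ Ω) : CPLe Φ Ω := by
  rw [CPLe, ← sub_add_sub_cancel]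
  exact IsCP.add h₂ h₁

theorem CPLe.smul {Φ Ψ : Superop A B} (h : CPLe Φ Ψ) {c : ℂ} (hc : 0 ≤ c) :
    CPLe (c • Φ) (c • Ψ) := by
  rw [CPLe, ← smul_sub c Ψ Φ]
  exact IsCP.smul h hc

theorem cpLe_inv_smul_iff {Φ Ψ : Superop A B} {c : ℂ} (hc : 0 < c) :
    CPLe Φ (c⁻¹ • Ψ) ↔ CPLe (c • Φ) Ψ := by
  constructor
  · intro h
    simpa only [smul_inv_smul₀ hc.ne'] using h.smul hc.le
  · intro h
    simpa only [inv_smul_smul₀ hc.ne'] using h.smul (inv_nonneg.2 hc.le)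

theorem IsCP.smul_mono {Φ : Superop A B} (hΦ : IsCP Φ) {c d : ℂ} (hcd : c ≤ d) :
    CPLe (c • Φ) (d • Φ) := by
  rw [CPLe, ← sub_smul d c Φ]
  exact hΦ.smul (sub_nonneg.2 hcd)

theorem CPLe.comp_left {Φ Ψ : Superop A B} (h : CPLe Φ Ψ) {E : Superop B C} (hE : IsCP E) :
    CPLe (E ∘ₗ Φ) (E ∘ₗ Ψ) := by
  rw [CPLe, ← LinearMap.comp_sub]
  exact isCP_comp hE h

theorem CPLe.comp_right {Φ Ψ : Superop B C} (h : CPLe Φ Ψ) {E : Superop A B} (hE : IsCP E) :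
    CPLe (Φ ∘ₗ E) (Ψ ∘ₗ E) :=
  isCP_comp h hE

theorem CPLe.lTensor {Φ Ψ : Superop A B} (h : CPLe Φ Ψ) (K : Type) [Finite K] :
    CPLe (lTensor K Φ) (lTensor K Ψ) :=
  isCP_lTensor K h

theorem CPLe.rTensor {Φ Ψ : Superop A B} (h : CPLe Φ Ψ) (K : Type) [Finite K] :
    CPLe (rTensor K Φ) (rTensor K Ψ) :=
  isCP_rTensor K h

theorem CPLe.tensor [Finite A] [Finite B'] {Φ Φ' : Superop A B} {Ψ Ψ' : Superop A' B'}
    (h₁ : CPLe Φ Φ') (h₂ : CPLe Ψ Ψ') (hΦ : IsCP Φ) (hΨ' : IsCP Ψ') :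
    CPLe (tensor Φ Ψ) (tensor Φ' Ψ') :=
  ((h₂.lTensor A).comp_left (isCP_rTensor B' hΦ)).trans
    ((h₁.rTensor B').comp_right (isCP_lTensor A hΨ'))

theorem tensor_smul_smul (s t : ℂ) (Φ : Superop A B) (Ψ : Superop A' B') :
    tensor (s • Φ) (t • Ψ) = (s * t) • tensor Φ Ψ := by
  have h : tensor (s • Φ) (t • Ψ) = (s • rTensor B' Φ) ∘ₗ (t • lTensor A Ψ) := rfl
  rw [h, LinearMap.smul_comp, LinearMap.comp_smul, smul_smul]
  rfl

/-! ### Quadratic forms of completely positive maps -/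

/-- The quadratic form of `(id ⊗ Φ) X`, through which the order `CPLe` becomes a family of scalar
inequalities. -/
def lTensorForm [Fintype B] (Φ : Superop A B) {K : Type} [Fintype K]
    (X : Matrix (K × A) (K × A) ℂ) (w : K × B → ℂ) : ℂ :=
  star w ⬝ᵥ lTensor K Φ X *ᵥ w

theorem lTensorForm_sub [Fintype B] (Φ Ψ : Superop A B) {K : Type} [Fintype K]
    (X : Matrix (K × A) (K × A) ℂ) (w : K × B → ℂ) :
    lTensorForm (Φ - Ψ) X w = lTensorForm Φ X w - lTensorForm Ψ X w := by
  have h : lTensor K (Φ - Ψ) X = lTensor K Φ X - lTensor K Ψ X := rfl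
  rw [lTensorForm, h, Matrix.sub_mulVec, dotProduct_sub, lTensorForm, lTensorForm]

theorem lTensorForm_smul [Fintype B] (c : ℂ) (Φ : Superop A B) {K : Type} [Fintype K]
    (X : Matrix (K × A) (K × A) ℂ) (w : K × B → ℂ) :
    lTensorForm (c • Φ) X w = c * lTensorForm Φ X w := by
  have h : lTensor K (c • Φ) X = c • lTensor K Φ X := rfl
  rw [lTensorForm, h, Matrix.smul_mulVec, dotProduct_smul, smul_eq_mul, lTensorForm]

theorem IsCP.lTensorForm_nonneg [Fintype B] {Φ : Superop A B} (hΦ : IsCP Φ) {K : Type}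
    [Fintype K] {X : Matrix (K × A) (K × A) ℂ} (hX : X.PosSemidef) (w : K × B → ℂ) :
    0 ≤ lTensorForm Φ X w :=
  (hΦ K X hX).dotProduct_mulVec_nonneg w

theorem IsCP.exists_lTensorForm_eq [Fintype B] {Φ : Superop A B} (hΦ : IsCP Φ) {K : Type}
    [Fintype K] {X : Matrix (K × A) (K × A) ℂ} (hX : X.PosSemidef) (w : K × B → ℂ) :
    ∃ r : ℝ, 0 ≤ r ∧ lTensorForm Φ X w = r := by
  obtain ⟨r, hr, h⟩ := RCLike.nonneg_iff_exists_ofReal.1 (hΦ.lTensorForm_nonneg hX w)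
  exact ⟨r, hr, h.symm⟩

theorem cpLe_iff_lTensorForm_le [Fintype B] {Φ Ψ : Superop A B} (hΦ : IsCP Φ) (hΨ : IsCP Ψ) :
    CPLe Φ Ψ ↔ ∀ (K : Type) [Fintype K] (X : Matrix (K × A) (K × A) ℂ), X.PosSemidef →
      ∀ w, lTensorForm Φ X w ≤ lTensorForm Ψ X w := by
  constructor
  · intro h K _ X hX w
    rw [← sub_nonneg, ← lTensorForm_sub]
    exact IsCP.lTensorForm_nonneg h hX w
  · intro h K _ X hX
    have := Fintype.ofFinite K
    refine .of_dotProduct_mulVec_nonneg ((hΨ K X hX).1.sub (hΦ K X hX).1) fun w => ?_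
    change 0 ≤ lTensorForm (Ψ - Φ) X w
    rw [lTensorForm_sub, sub_nonneg]
    exact h K X hX w

theorem lTensor_tensor_kronecker (Φ : Superop A B) (Ψ : Superop A' B') {K L : Type}
    (X : Matrix (K × A) (K × A) ℂ) (Y : Matrix (L × A') (L × A') ℂ) :
    lTensor (K × L) (tensor Φ Ψ) ((X ⊗ₖ Y).submatrix (Equiv.prodProdProdComm K L A A')
        (Equiv.prodProdProdComm K L A A'))
      = (lTensor K Φ X ⊗ₖ lTensor L Ψ Y).submatrix (Equiv.prodProdProdComm K L B B')
        (Equiv.prodProdProdComm K L B B') := by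
  ext p q
  exact congrFun (congrFun (tensor_kronecker Φ Ψ
    (Matrix.of fun a a' => X (p.1.1, a) (q.1.1, a'))
    (Matrix.of fun a a' => Y (p.1.2, a) (q.1.2, a'))) p.2) q.2

theorem lTensorForm_tensor [Fintype B] [Fintype B'] (Φ : Superop A B) (Ψ : Superop A' B')
    {K L : Type} [Fintype K] [Fintype L] (X : Matrix (K × A) (K × A) ℂ)
    (Y : Matrix (L × A') (L × A') ℂ) (v : K × B → ℂ) (w : L × B' → ℂ) :
    lTensorForm (tensor Φ Ψ) ((X ⊗ₖ Y).submatrix (Equiv.prodProdProdComm K L A A')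
        (Equiv.prodProdProdComm K L A A')) (fun p => v (p.1.1, p.2.1) * w (p.1.2, p.2.2))
      = lTensorForm Φ X v * lTensorForm Ψ Y w := by
  simp only [lTensorForm, dotProduct, Matrix.mulVec, lTensor_tensor_kronecker,
    Matrix.submatrix_apply, Matrix.kroneckerMap_apply, Pi.star_apply]
  rw [Fintype.sum_mul_sum, ← Fintype.sum_prod_type']
  refine Fintype.sum_equiv (Equiv.prodProdProdComm K L B B') _ _ fun p => ?_
  rw [mul_mul_mul_comm, Fintype.sum_mul_sum, ← Fintype.sum_prod_type', star_mul']
  congr 1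
  refine Fintype.sum_equiv (Equiv.prodProdProdComm K L B B') _ _ fun q => ?_
  simp only [Equiv.prodProdProdComm_apply]
  ring

theorem CPLe.of_tensor [Finite A] [Finite B] [Finite A'] [Finite B'] {Φ Φ' : Superop A B}
    {Ψ Ψ' : Superop A' B'} (hΦ : IsCP Φ) (hΦ' : IsCP Φ') (hΨ : IsCP Ψ) (hΨ' : IsCP Ψ') {s t : ℝ}
    (hs : 0 ≤ s) (ht : 0 < t) (h : CPLe (QChannel.tensor Φ Ψ) ((s : ℂ) • QChannel.tensor Φ' Ψ'))
    (hmin : ∀ r : ℝ, 0 ≤ r → CPLe Ψ ((r : ℂ) • Ψ') → t ≤ r) :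
    CPLe Φ (((s / t : ℝ) : ℂ) • Φ') := by
  have := Fintype.ofFinite B
  have := Fintype.ofFinite B'
  have hs' : (0 : ℂ) ≤ s := Complex.zero_le_real.2 hs
  have hst : (0 : ℂ) ≤ (s / t : ℝ) := Complex.zero_le_real.2 (by positivity)
  rw [cpLe_iff_lTensorForm_le hΦ (hΦ'.smul hst)]
  intro K _ X hX v
  obtain ⟨a, ha, haΦ⟩ := hΦ.exists_lTensorForm_eq hX v
  obtain ⟨a', ha', haΦ'⟩ := hΦ'.exists_lTensorForm_eq hX v
  suffices a ≤ s / t * a' by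
    rw [lTensorForm_smul, haΦ, haΦ']
    exact_mod_cast this
  obtain rfl | ha := ha.eq_or_lt
  · positivity
  -- The product inequality at a fixed argument on the first factor bounds the ratio of the two
  -- forms on the second factor, and `t` is the least such bound.
  have hratio : CPLe Ψ (((s * a' / a : ℝ) : ℂ) • Ψ') := by
    rw [cpLe_iff_lTensorForm_le hΨ (hΨ'.smul (Complex.zero_le_real.2 (by positivity)))]
    intro L _ Y hY w
    obtain ⟨b, -, hbΨ⟩ := hΨ.exists_lTensorForm_eq hY w
    obtain ⟨b', -, hbΨ'⟩ := hΨ'.exists_lTensorForm_eq hY w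
    have hprod := (cpLe_iff_lTensorForm_le (hΦ.tensor hΨ) ((hΦ'.tensor hΨ').smul hs')).1 h (K × L) _
      ((hX.kronecker hY).submatrix (Equiv.prodProdProdComm K L A A'))
      (fun p => v (p.1.1, p.2.1) * w (p.1.2, p.2.2))
    rw [lTensorForm_smul, lTensorForm_tensor, lTensorForm_tensor, haΦ, haΦ', hbΨ, hbΨ'] at hprod
    norm_cast at hprod
    rw [lTensorForm_smul, hbΨ, hbΨ']
    norm_cast
    rw [div_mul_eq_mul_div, le_div_iff₀ ha]
    linarith
  have hle := hmin _ (by positivity) hratio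
  rw [le_div_iff₀ ha] at hle
  rw [div_mul_eq_mul_div, le_div_iff₀ ht]
  linarith

/-! ### The trace map and conditionally unital maps -/

/-- The completely positive map `X ↦ Tr[X] · 1`, which is `|B|` times the uniform channel and
against which the min-entropy compares a channel. -/
def traceOne (A B : Type) [Fintype A] [DecidableEq B] : Superop A B :=
  (Matrix.traceLinearMap A ℂ ℂ).smulRight 1

theorem traceOne_apply [Fintype A] [DecidableEq B] (X : Matrix A A ℂ) :
    traceOne A B X = X.trace • (1 : Matrix B B ℂ) := rfl

theorem trace_traceOne [Fintype A] [Fintype B] [DecidableEq B] (X : Matrix A A ℂ) :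
    (traceOne A B X).trace = Fintype.card B * X.trace := by
  rw [traceOne_apply, Matrix.trace_smul, Matrix.trace_one, smul_eq_mul, mul_comm]

theorem card_smul_uniformSuperop [Fintype A] [Fintype B] [DecidableEq B] :
    (Fintype.card B : ℂ) • uniformSuperop A B = traceOne A B := by
  refine LinearMap.ext fun X => ?_
  obtain _ | _ := isEmpty_or_nonempty B
  · exact Subsingleton.elim _ _
  · have h : uniformSuperop A B X = (X.trace / (Fintype.card B : ℂ)) • (1 : Matrix B B ℂ) := rfl
    have hB : (Fintype.card B : ℂ) ≠ 0 := by simp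
    rw [LinearMap.smul_apply, h, smul_smul, mul_div_cancel₀ _ hB, traceOne_apply]

theorem isCP_traceOne (A B : Type) [Fintype A] [Finite B] [DecidableEq B] :
    IsCP (traceOne A B) := by
  have := Fintype.ofFinite B
  rw [← card_smul_uniformSuperop]
  exact (isCP_uniformSuperop A B).smul (Nat.cast_nonneg _)

theorem tensor_traceOne [Fintype A] [Fintype A'] [DecidableEq B] [DecidableEq B'] :
    tensor (traceOne A B) (traceOne A' B') = traceOne (A × A') (B × B') := by
  refine LinearMap.ext fun X => ?_
  ext p q
  simp [tensor, lTensor, rTensor, traceOne_apply, Matrix.trace, Fintype.sum_prod_type,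
    Matrix.one_apply, Prod.ext_iff, ite_and]

/-- The diagonal block `X ↦ (1 ⊗ ⟨b|) X (1 ⊗ |b⟩)`: the unnormalized state of the first system after
a measurement of the second one in its basis has given the outcome `b`. -/
def diagBlock (b : B) : Superop (A × B) A where
  toFun X := X.submatrix (·, b) (·, b)
  map_add' _ _ := rfl
  map_smul' _ _ := rfl

theorem diagBlock_apply (b : B) (X : Matrix (A × B) (A × B) ℂ) (a a' : A) :
    diagBlock b X a a' = X (a, b) (a', b) := rfl

theorem isCP_diagBlock (b : B) : IsCP (diagBlock b : Superop (A × B) A) :=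
  fun K _ _ hX => hX.submatrix fun p : K × A => (p.1, (p.2, b))

theorem diagBlock_kronecker (b : B) (X : Matrix A A ℂ) (Y : Matrix B B ℂ) :
    diagBlock b (X ⊗ₖ Y) = Y b b • X := by
  ext a a'
  exact mul_comm _ _

theorem sum_trace_diagBlock [Fintype A] [Fintype B] (X : Matrix (A × B) (A × B) ℂ) :
    ∑ b, (diagBlock b X).trace = X.trace :=
  (Fintype.sum_prod_type_right fun p => X p p).symm

theorem lTensor_traceOne [Fintype A] [DecidableEq B] (K : Type)
    (X : Matrix (K × A) (K × A) ℂ) :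
    lTensor K (traceOne A B) X = (∑ a, diagBlock a X) ⊗ₖ (1 : Matrix B B ℂ) := by
  ext p q
  simp [lTensor, traceOne_apply, diagBlock_apply, Matrix.trace, Matrix.sum_apply]

open scoped MatrixOrder Matrix.Norms.L2Operator in
theorem span_isState (R : Type) [Fintype R] :
    Submodule.span ℂ {τ : Matrix R R ℂ | IsState τ} = ⊤ := by
  classical
  have hspan : Submodule.span ℂ {X : Matrix R R ℂ | X.PosSemidef} = ⊤ := by
    simpa only [Matrix.nonneg_iff_posSemidef] using CStarAlgebra.span_nonneg (A := Matrix R R ℂ)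
  rw [eq_top_iff, ← hspan, Submodule.span_le]
  intro X (hX : X.PosSemidef)
  by_cases htr : X.trace = 0
  · rw [hX.trace_eq_zero_iff.1 htr]
    exact zero_mem _
  · have hstate : IsState (X.trace⁻¹ • X) :=
      ⟨hX.smul (inv_nonneg.2 hX.trace_nonneg), by simp [htr]⟩
    rw [← smul_inv_smul₀ htr X]
    exact Submodule.smul_mem _ _ (Submodule.subset_span hstate)

theorem IsConditionallyUnital.apply_kronecker_one {R : Type} [Fintype R] [DecidableEq B]
    {E : Superop (R × B) B} (hE : IsConditionallyUnital E) (τ : Matrix R R ℂ) :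
    E (τ ⊗ₖ (1 : Matrix B B ℂ)) = τ.trace • (1 : Matrix B B ℂ) := by
  have h : E ∘ₗ (Matrix.kroneckerBilinear (R := ℂ) (α := ℂ)).flip 1 = traceOne R B :=
    LinearMap.ext_on (span_isState R) fun τ hτ => by
      rw [traceOne_apply, hτ.2, one_smul]
      exact hE τ hτ
  exact LinearMap.congr_fun h τ

theorem IsCP.eq_zero_of_trace_eq_zero [Finite A] [Fintype B] {Φ : Superop A B} (hΦ : IsCP Φ)
    (h : ∀ X, (Φ X).trace = 0) : Φ = 0 :=
  have := Fintype.ofFinite A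
  LinearMap.ext_on (span_isState A) fun τ hτ => (hΦ.posSemidef hτ.1).trace_eq_zero_iff.1 (h τ)

/-! ### Monotonicity under superchannels -/

theorem IsIsometry.card_le [Fintype A] [DecidableEq A] [Fintype B] {V : Matrix B A ℂ}
    (hV : IsIsometry V) : Fintype.card A ≤ Fintype.card B := by
  rw [← Matrix.rank_one (R := ℂ) (n := A), ← hV]
  exact (Matrix.rank_mul_le_right _ _).trans (Matrix.rank_le_card_height V)

theorem IsIsometry.trace_conjBy [Fintype A] [DecidableEq A] [Fintype B] {V : Matrix B A ℂ}
    (hV : IsIsometry V) (X : Matrix A A ℂ) : (conjBy V X).trace = X.trace := by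
  change (V * X * Vᴴ).trace = X.trace
  rw [Matrix.trace_mul_comm, ← Matrix.mul_assoc, hV, Matrix.one_mul]

theorem IsIsometry.conjBy_conjTranspose_comp_conjBy [Fintype A] [DecidableEq A] [Fintype B]
    {V : Matrix B A ℂ} (hV : IsIsometry V) : conjBy Vᴴ ∘ₗ conjBy V = LinearMap.id := by
  refine LinearMap.ext fun X => ?_
  change Vᴴ * (V * X * Vᴴ) * Vᴴᴴ = X
  rw [Matrix.conjTranspose_conjTranspose, ← Matrix.mul_assoc, ← Matrix.mul_assoc, hV,
    Matrix.one_mul, Matrix.mul_assoc, hV, Matrix.mul_one]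

theorem conjBy_traceOne [Fintype A] [Fintype B] [DecidableEq B] (V : Matrix C B ℂ)
    (X : Matrix A A ℂ) : conjBy V (traceOne A B X) = X.trace • (V * Vᴴ) := by
  rw [traceOne_apply, map_smul]
  change X.trace • (V * (1 : Matrix B B ℂ) * Vᴴ) = _
  rw [Matrix.mul_one]

theorem IsIsometry.conjBy_conjTranspose_comp_traceOne [Fintype A] [DecidableEq B] [Fintype C]
    [DecidableEq C] {V : Matrix C B ℂ} (hV : IsIsometry V) :
    conjBy Vᴴ ∘ₗ traceOne A C = traceOne A B := by
  refine LinearMap.ext fun X => ?_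
  rw [LinearMap.comp_apply, conjBy_traceOne, Matrix.conjTranspose_conjTranspose, hV,
    traceOne_apply]

theorem IsIsometry.conjBy_comp_traceOne_le [Fintype A] [Fintype B] [DecidableEq B] [Fintype C]
    [DecidableEq C] {V : Matrix C B ℂ} (hV : IsIsometry V) :
    CPLe (conjBy V ∘ₗ traceOne A B) (traceOne A C) := by
  -- The difference is conjugation by the projection `1 - V Vᴴ` applied after the trace map.
  have hproj : (1 - V * Vᴴ) * (1 - V * Vᴴ)ᴴ = 1 - V * Vᴴ := by
    have hV' : Vᴴ * V = 1 := hV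
    have h : V * Vᴴ * (V * Vᴴ) = V * Vᴴ := by
      rw [Matrix.mul_assoc, ← Matrix.mul_assoc Vᴴ, hV', Matrix.one_mul]
    simp [Matrix.mul_sub, Matrix.sub_mul, h]
  have h : traceOne A C - conjBy V ∘ₗ traceOne A B = conjBy (1 - V * Vᴴ) ∘ₗ traceOne A C := by
    refine LinearMap.ext fun X => ?_
    rw [LinearMap.sub_apply, LinearMap.comp_apply, LinearMap.comp_apply, conjBy_traceOne,
      conjBy_traceOne, hproj, smul_sub, traceOne_apply]
  rw [CPLe, h]
  exact isCP_comp (isCP_conjBy _) (isCP_traceOne A C)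

theorem IsRealization.map_cpLe {R : Type} [Fintype A] [Fintype A'] [DecidableEq A'] [Fintype B]
    [Fintype R] {Θ : Superop A B →ₗ[ℂ] Superop A' B} {V : Matrix (R × A) A' ℂ}
    {E : Superop (R × B) B} (hΘ : IsRealization Θ R V E) {Φ Ψ : Superop A B} (h : CPLe Φ Ψ) :
    CPLe (Θ Φ) (Θ Ψ) := by
  rw [hΘ.action, hΘ.action]
  exact ((h.lTensor R).comp_right (isCP_conjBy V)).comp_left hΘ.channel.1

theorem IsRealization.map_traceOne {R : Type} [Fintype A] [Fintype A'] [DecidableEq A']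
    [Fintype B] [DecidableEq B] [Fintype R] {Θ : Superop A B →ₗ[ℂ] Superop A' B}
    {V : Matrix (R × A) A' ℂ} {E : Superop (R × B) B} (hΘ : IsRealization Θ R V E)
    (hE : IsConditionallyUnital E) : Θ (traceOne A B) = traceOne A' B := by
  refine LinearMap.ext fun X => ?_
  have htrace : (∑ a, diagBlock a (conjBy V X)).trace = X.trace := by
    rw [Matrix.trace_sum, sum_trace_diagBlock, hΘ.isometry.trace_conjBy]
  rw [hΘ.action, LinearMap.comp_apply, LinearMap.comp_apply, lTensor_traceOne,
    hE.apply_kronecker_one, htrace, traceOne_apply]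

theorem MajorizesSame.cpLe_smul_traceOne [Fintype A] [Fintype A'] [DecidableEq A'] [Fintype B]
    [DecidableEq B] {N : Superop A B} {M : Superop A' B} (h : MajorizesSame N M) {s : ℂ}
    (hN : CPLe N (s • traceOne A B)) : CPLe M (s • traceOne A' B) := by
  obtain ⟨Θ, ⟨R, _, V, E, ⟨hΘ, -⟩, hE⟩, rfl⟩ := h
  rw [← hΘ.map_traceOne hE, ← map_smul]
  exact hΘ.map_cpLe hN

theorem IsIsometry.cpLe_smul_traceOne_of_conjBy [Fintype A] [Fintype B] [DecidableEq B]
    [Fintype C] [DecidableEq C] {U : Matrix C B ℂ} (hU : IsIsometry U) {N : Superop A B} {s : ℂ}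
    (h : CPLe (conjBy U ∘ₗ N) (s • traceOne A C)) : CPLe N (s • traceOne A B) := by
  have h' := h.comp_left (isCP_conjBy Uᴴ)
  rwa [← LinearMap.comp_assoc, hU.conjBy_conjTranspose_comp_conjBy, LinearMap.id_comp,
    LinearMap.comp_smul, hU.conjBy_conjTranspose_comp_traceOne] at h'

theorem IsIsometry.conjBy_cpLe_smul_traceOne [Fintype A] [Fintype B] [DecidableEq B] [Fintype C]
    [DecidableEq C] {V : Matrix C B ℂ} (hV : IsIsometry V) {N : Superop A B} {s : ℂ} (hs : 0 ≤ s)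
    (h : CPLe N (s • traceOne A B)) : CPLe (conjBy V ∘ₗ N) (s • traceOne A C) := by
  have h' := h.comp_left (isCP_conjBy V)
  rw [LinearMap.comp_smul] at h'
  exact h'.trans (hV.conjBy_comp_traceOne_le.smul hs)

theorem Majorizes.cpLe_smul_traceOne [Fintype A] [Fintype A'] [DecidableEq A'] [Fintype B]
    [DecidableEq B] [Fintype B'] [DecidableEq B'] {N : Channel A B} {M : Channel A' B'}
    (h : Majorizes N M) {s : ℂ} (hs : 0 ≤ s) (hN : CPLe N.1 (s • traceOne A B)) :
    CPLe M.1 (s • traceOne A' B') := by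
  obtain ⟨-, U, hU, h⟩ | ⟨-, V, hV, h⟩ := h
  · exact hU.cpLe_smul_traceOne_of_conjBy (h.cpLe_smul_traceOne hN)
  · exact h.cpLe_smul_traceOne (hV.conjBy_cpLe_smul_traceOne hs hN)

/-! ### The min-entropy -/

theorem cpLe_smul_uniformChannel_iff [Fintype A] [Nonempty A] [Fintype B] [DecidableEq B]
    [Nonempty B] (N : Channel A B) (t : ℝ) :
    CPLe N.1 ((t : ℂ) • (uniformChannel A B).1) ↔ (2 : ℝ) ^ dmax N (uniformChannel A B) ≤ t := by
  constructor
  · intro h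
    have ht : 0 < t := one_pos.trans_le (one_le_of_isCP N h)
    rw [← Real.le_logb_iff_rpow_le one_lt_two ht]
    exact (isLeast_dmax_uniform N).2 ⟨t, ht, h, rfl⟩
  · intro h
    obtain ⟨t₀, ht₀, hN, heq⟩ := (isLeast_dmax_uniform N).1
    rw [heq, Real.rpow_logb two_pos (by norm_num) ht₀] at h
    exact CPLe.trans hN ((uniformChannel A B).2.1.smul_mono (Complex.real_le_real.2 h))

theorem dmax_uniformChannel_nonneg [Fintype A] [Nonempty A] [Fintype B] [DecidableEq B]
    [Nonempty B] (N : Channel A B) : 0 ≤ dmax N (uniformChannel A B) := by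
  obtain ⟨t, -, hN, heq⟩ := (isLeast_dmax_uniform N).1
  rw [heq]
  exact Real.logb_nonneg one_lt_two (one_le_of_isCP N hN)

section MinEntropy

variable [Fintype A] [DecidableEq A] [Nonempty A] [Fintype B] [DecidableEq B] [Nonempty B]
  [Fintype A'] [DecidableEq A'] [Nonempty A'] [Fintype B'] [DecidableEq B'] [Nonempty B']

theorem cpLe_smul_traceOne_iff (N : Channel A B) (s : ℝ) :
    CPLe N.1 ((s : ℂ) • traceOne A B) ↔ (2 : ℝ) ^ (-channelMinEntropy A B N) ≤ s := by
  have hB : (0 : ℝ) < Fintype.card B := by exact_mod_cast Fintype.card_pos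
  have hT : (s : ℂ) • traceOne A B
      = ((s * Fintype.card B : ℝ) : ℂ) • (uniformChannel A B).1 := by
    rw [← card_smul_uniformSuperop, smul_smul, Complex.ofReal_mul, Complex.ofReal_natCast]
    rfl
  rw [hT, cpLe_smul_uniformChannel_iff, channelMinEntropy, neg_sub, Real.rpow_sub two_pos,
    Real.rpow_logb two_pos (by norm_num) hB, div_le_iff₀ hB]

theorem cpLe_rpow_neg_channelMinEntropy (N : Channel A B) :
    CPLe N.1 (((2 ^ (-channelMinEntropy A B N) : ℝ) : ℂ) • traceOne A B) :=
  (cpLe_smul_traceOne_iff N _).2 le_rfl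

theorem le_channelMinEntropy_iff (N : Channel A B) (x : ℝ) :
    x ≤ channelMinEntropy A B N ↔ CPLe N.1 (((2 ^ (-x) : ℝ) : ℂ) • traceOne A B) := by
  rw [cpLe_smul_traceOne_iff, Real.rpow_le_rpow_left_iff one_lt_two, neg_le_neg_iff]

theorem logb_natCast_le_channelMinEntropy_iff (N : Channel A B) {k : ℕ} (hk : 0 < k) :
    Real.logb 2 k ≤ channelMinEntropy A B N ↔ CPLe ((k : ℂ) • N.1) (traceOne A B) := by
  have hk' : (0 : ℝ) < k := Nat.cast_pos.2 hk
  rw [le_channelMinEntropy_iff, Real.rpow_neg two_pos.le,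
    Real.rpow_logb two_pos (by norm_num) hk', Complex.ofReal_inv, Complex.ofReal_natCast,
    cpLe_inv_smul_iff (Nat.cast_pos.2 hk)]

theorem channelMinEntropy_le_logb_card (N : Channel A B) :
    channelMinEntropy A B N ≤ Real.logb 2 (Fintype.card B) :=
  sub_le_self _ (dmax_uniformChannel_nonneg N)

theorem channelMinEntropy_uniformChannel :
    channelMinEntropy A B (uniformChannel A B) = Real.logb 2 (Fintype.card B) := by
  refine (channelMinEntropy_le_logb_card _).antisymm ?_
  rw [logb_natCast_le_channelMinEntropy_iff _ Fintype.card_pos]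
  change CPLe ((Fintype.card B : ℂ) • uniformSuperop A B) _
  rw [card_smul_uniformSuperop]
  exact CPLe.refl _

theorem channelMinEntropy_le_of_majorizes {N : Channel A B} {M : Channel A' B'}
    (h : Majorizes N M) : channelMinEntropy A B N ≤ channelMinEntropy A' B' M := by
  rw [le_channelMinEntropy_iff]
  exact h.cpLe_smul_traceOne (Complex.zero_le_real.2 (by positivity))
    (cpLe_rpow_neg_channelMinEntropy N)

theorem channelMinEntropy_add_le_tensor (N : Channel A B) (M : Channel A' B') :
    channelMinEntropy A B N + channelMinEntropy A' B' M
      ≤ channelMinEntropy (A × A') (B × B') (N.tensor M) := by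
  rw [le_channelMinEntropy_iff, neg_add, Real.rpow_add two_pos, Complex.ofReal_mul,
    ← tensor_traceOne, ← tensor_smul_smul]
  exact (cpLe_rpow_neg_channelMinEntropy N).tensor (cpLe_rpow_neg_channelMinEntropy M) N.2.1
    ((isCP_traceOne A' B').smul (Complex.zero_le_real.2 (by positivity)))

theorem channelMinEntropy_tensor_le_add (N : Channel A B) (M : Channel A' B') :
    channelMinEntropy (A × A') (B × B') (N.tensor M)
      ≤ channelMinEntropy A B N + channelMinEntropy A' B' M := by
  have hNM : CPLe (tensor N.1 M.1) (((2 ^ (-channelMinEntropy _ _ (N.tensor M)) : ℝ) : ℂ) •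
      tensor (traceOne A B) (traceOne A' B')) := by
    rw [tensor_traceOne]
    exact cpLe_rpow_neg_channelMinEntropy (N.tensor M)
  have hN := CPLe.of_tensor N.2.1 (isCP_traceOne A B) M.2.1 (isCP_traceOne A' B')
    (by positivity) (by positivity) hNM fun r _ => (cpLe_smul_traceOne_iff M r).1
  rw [← Real.rpow_sub two_pos, cpLe_smul_traceOne_iff,
    Real.rpow_le_rpow_left_iff one_lt_two] at hN
  linarith

end MinEntropy

theorem isChannelEntropy_channelMinEntropy : IsChannelEntropy channelMinEntropy where
  nonzero := ⟨Unit, Fin 2, inferInstance, inferInstance, inferInstance, inferInstance,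
    inferInstance, inferInstance, uniformChannel Unit (Fin 2), by
      simp [channelMinEntropy_uniformChannel]⟩
  monotone _ _ _ _ _ _ _ _ _ _ _ _ _ _ _ _ _ _ := channelMinEntropy_le_of_majorizes
  additive _ _ _ _ _ _ _ _ _ _ _ _ _ _ _ _ N M :=
    (channelMinEntropy_tensor_le_add N M).antisymm (channelMinEntropy_add_le_tensor N M)

theorem isNormalized_channelMinEntropy : IsNormalized channelMinEntropy := by
  simp [IsNormalized, channelMinEntropy_uniformChannel]

/-! ### Majorization by uniform states -/

/-- The superchannel `N ↦ E ∘ (id ⊗ N) ∘ (V · Vᴴ)` with pre-processing `V` and post-processing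
`E`. -/
def superchannel {R : Type} [Fintype A'] (V : Matrix (R × A) A' ℂ) (E : Superop (R × B) B) :
    Superop A B →ₗ[ℂ] Superop A' B where
  toFun N := E ∘ₗ lTensor R N ∘ₗ conjBy V
  map_add' N M := by
    have h : lTensor R (N + M) = lTensor R N + lTensor R M := rfl
    rw [h, LinearMap.add_comp, LinearMap.comp_add]
  map_smul' c N := by
    have h : lTensor R (c • N) = c • lTensor R N := rfl
    rw [h, LinearMap.smul_comp, LinearMap.comp_smul]
    rfl

theorem IsRealization.isStandardForm {R : Type} [Fintype A] [Nonempty A] [Fintype A']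
    [DecidableEq A'] [Fintype B] [Fintype R] {Θ : Superop A B →ₗ[ℂ] Superop A' B}
    {V : Matrix (R × A) A' ℂ} {E : Superop (R × B) B} (hΘ : IsRealization Θ R V E)
    (hcard : Fintype.card R * Fintype.card A ≤ Fintype.card A') : IsStandardForm Θ R V E where
  realization := hΘ
  minimal R' _ _ _ hΘ' := by
    have h := hcard.trans hΘ'.isometry.card_le
    rw [Fintype.card_prod] at h
    exact Nat.le_of_mul_le_mul_right h Fintype.card_pos

/-- The matrix of the linear map that sends the basis vector `a` to the basis vector `f a`. -/
def embeddingMatrix [DecidableEq B] (f : A → B) : Matrix B A ℂ :=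
  (1 : Matrix B B ℂ).submatrix id f

theorem isIsometry_embeddingMatrix [DecidableEq A] [Fintype B] [DecidableEq B] {f : A → B}
    (hf : f.Injective) : IsIsometry (embeddingMatrix f) := by
  have h : (embeddingMatrix f)ᴴ * embeddingMatrix f = (1 : Matrix B B ℂ).submatrix f f := by
    rw [embeddingMatrix, Matrix.conjTranspose_submatrix, Matrix.conjTranspose_one,
      ← Matrix.submatrix_mul _ _ _ _ _ Function.bijective_id, Matrix.one_mul]
  rw [IsIsometry, h, Matrix.submatrix_one f hf]

theorem sum_embeddingMatrix_mul_conjTranspose_smul {M : Type*} [AddCommGroup M] [Module ℂ M]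
    [Fintype A] [Fintype B] [DecidableEq B] (f : A → B) (g : B → M) :
    ∑ b, (embeddingMatrix f * (embeddingMatrix f)ᴴ) b b • g b = ∑ a, g (f a) := by
  simp only [Matrix.mul_apply, Finset.sum_smul]
  rw [Finset.sum_comm]
  simp [embeddingMatrix, Matrix.one_apply, apply_ite, ite_smul]

theorem conjBy_embeddingMatrix_equiv [Fintype A] [DecidableEq B] (e : A ≃ B)
    (X : Matrix A A ℂ) : conjBy (embeddingMatrix e) X = X.submatrix e.symm e.symm := by
  have := Finite.of_equiv A e
  change (1 : Matrix B B ℂ).submatrix id e * X * ((1 : Matrix B B ℂ).submatrix id e)ᴴ = _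
  rw [Matrix.conjTranspose_submatrix, Matrix.conjTranspose_one, Matrix.one_submatrix_mul,
    Matrix.mul_submatrix_one]
  rfl

theorem lTensor_submatrix_fst {A₀ : Type} [DecidableEq A₀] [Unique A₀] (Φ : Superop A₀ B)
    (X : Matrix A A ℂ) : lTensor A Φ (X.submatrix Prod.fst Prod.fst) = X ⊗ₖ Φ 1 := by
  ext p q
  have h : (Matrix.of fun _ _ : A₀ => X p.1 q.1) = X p.1 q.1 • 1 := by
    ext i j
    simp [Subsingleton.elim i j]
  change Φ (Matrix.of fun _ _ => X p.1 q.1) p.2 q.2 = _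
  rw [h, map_smul]
  rfl

theorem IsConditionallyUnital.majorizesSame {A₀ : Type} [Fintype A₀] [DecidableEq A₀]
    [Unique A₀] [Fintype A] [DecidableEq A] [Fintype B] [DecidableEq B] {E : Superop (A × B) B}
    (hE : IsConditionallyUnital E) (hcp : IsCP E) (htp : IsTP E) {Φ : Superop A₀ B}
    {M : Superop A B} (hM : ∀ X, M X = E (X ⊗ₖ Φ 1)) : MajorizesSame Φ M := by
  set V : Matrix (A × A₀) A ℂ := embeddingMatrix (Equiv.prodUnique A A₀).symm with hV
  have hΘ : IsRealization (superchannel V E) A V E :=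
    ⟨isIsometry_embeddingMatrix (Equiv.injective _), ⟨hcp, htp⟩, fun _ => rfl⟩
  refine ⟨superchannel V E, ⟨A, _, V, E, hΘ.isStandardForm (by simp), hE⟩,
    LinearMap.ext fun X => ?_⟩
  rw [hΘ.action, LinearMap.comp_apply, LinearMap.comp_apply, hV, conjBy_embeddingMatrix_equiv, hM,
    ← lTensor_submatrix_fst]
  rfl

/-- The operation that measures the second system in its basis and applies `Φ b` to the first system
when the outcome is `b`. -/
def measureControlled [Fintype B] (Φ : B → Superop A C) : Superop (A × B) C :=
  ∑ b, Φ b ∘ₗ diagBlock b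

theorem measureControlled_apply [Fintype B] (Φ : B → Superop A C)
    (X : Matrix (A × B) (A × B) ℂ) : measureControlled Φ X = ∑ b, Φ b (diagBlock b X) := by
  simp [measureControlled]

theorem measureControlled_kronecker [Fintype B] (Φ : B → Superop A C) (X : Matrix A A ℂ)
    (Y : Matrix B B ℂ) : measureControlled Φ (X ⊗ₖ Y) = ∑ b, Y b b • Φ b X := by
  simp only [measureControlled_apply, diagBlock_kronecker, map_smul]

theorem isCP_measureControlled [Fintype B] {Φ : B → Superop A C} (hΦ : ∀ b, IsCP (Φ b)) :
    IsCP (measureControlled Φ) :=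
  IsCP.sum fun b _ => isCP_comp (hΦ b) (isCP_diagBlock b)

theorem isTP_measureControlled [Fintype A] [Fintype B] [Fintype C] {Φ : B → Superop A C}
    (hΦ : ∀ b, IsTP (Φ b)) : IsTP (measureControlled Φ) := by
  intro X
  rw [measureControlled_apply, Matrix.trace_sum, ← sum_trace_diagBlock X]
  exact Finset.sum_congr rfl fun b _ => hΦ b _

theorem isConditionallyUnital_measureControlled [Fintype A] [Fintype B] [DecidableEq B]
    {Φ : B → Superop A B} (hΦ : ∑ b, Φ b = traceOne A B) :
    IsConditionallyUnital (measureControlled Φ) := by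
  intro τ hτ
  simp only [measureControlled_kronecker, Matrix.one_apply_eq, one_smul]
  rw [← LinearMap.sum_apply, hΦ, traceOne_apply, hτ.2, one_smul]

theorem exists_channel_smul_add_smul_eq_traceOne [Fintype A] [Fintype B] [DecidableEq B]
    {N : Channel A B} {k m : ℕ} (hkm : k + m = Fintype.card B)
    (h : CPLe ((k : ℂ) • N.1) (traceOne A B)) :
    ∃ M : Channel A B, (k : ℂ) • N.1 + (m : ℂ) • M.1 = traceOne A B := by
  have htrace (X : Matrix A A ℂ) : ((traceOne A B - (k : ℂ) • N.1) X).trace = m * X.trace := by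
    rw [LinearMap.sub_apply, Matrix.trace_sub, trace_traceOne, LinearMap.smul_apply,
      Matrix.trace_smul, N.2.2, ← hkm, Nat.cast_add, smul_eq_mul]
    ring
  obtain rfl | hm := eq_or_ne m 0
  · have hzero : traceOne A B - (k : ℂ) • N.1 = 0 :=
      IsCP.eq_zero_of_trace_eq_zero h fun X => by rw [htrace, Nat.cast_zero, zero_mul]
    exact ⟨N, by rw [Nat.cast_zero, zero_smul, add_zero, sub_eq_zero.1 hzero]⟩
  · have hm' : (m : ℂ) ≠ 0 := Nat.cast_ne_zero.2 hm
    refine ⟨⟨(m : ℂ)⁻¹ • (traceOne A B - (k : ℂ) • N.1),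
      IsCP.smul h (inv_nonneg.2 (Nat.cast_nonneg _)), fun X => ?_⟩, ?_⟩
    · rw [LinearMap.smul_apply, Matrix.trace_smul, htrace, smul_eq_mul, inv_mul_cancel_left₀ hm']
    · rw [smul_inv_smul₀ hm', add_sub_cancel]

theorem exists_channels_sum_eq_traceOne {B₀ : Type} [Fintype A] [Fintype B] [DecidableEq B]
    [Fintype B₀] (f : B₀ ↪ B) {N : Channel A B}
    (h : CPLe ((Fintype.card B₀ : ℂ) • N.1) (traceOne A B)) :
    ∃ Φ : B → Channel A B, (∀ b₀, Φ (f b₀) = N) ∧ ∑ b, (Φ b).1 = traceOne A B := by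
  set s : Finset B := Finset.univ.map f
  have hs : s.card = Fintype.card B₀ := Finset.card_map f
  rw [← hs] at h
  obtain ⟨M, hM⟩ := exists_channel_smul_add_smul_eq_traceOne s.card_add_card_compl h
  set Φ : B → Channel A B := fun b => if b ∈ s then N else M
  have hΦN : ∀ b ∈ s, Φ b = N := fun b hb => if_pos hb
  have hΦM : ∀ b ∈ sᶜ, Φ b = M := fun b hb => if_neg (Finset.mem_compl.1 hb)
  refine ⟨Φ, fun b₀ => hΦN _ (Finset.mem_map_of_mem f (Finset.mem_univ b₀)), ?_⟩
  rw [← hM, ← Finset.sum_add_sum_compl s,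
    Finset.sum_congr rfl fun b hb => congrArg Subtype.val (hΦN b hb),
    Finset.sum_congr rfl fun b hb => congrArg Subtype.val (hΦM b hb),
    Finset.sum_const, Finset.sum_const, Nat.cast_smul_eq_nsmul, Nat.cast_smul_eq_nsmul]

theorem uniformSuperop_one {A₀ : Type} [Fintype A₀] [DecidableEq A₀] [Unique A₀] [Fintype B]
    [DecidableEq B] : uniformSuperop A₀ B 1 = (Fintype.card B : ℂ)⁻¹ • 1 := by
  simp [uniformSuperop]

/-- The post-processing measures the basis of `B`, applies `N` when the outcome belongs to the image
of `B₀`, which is certain, and otherwise a channel that makes the average over `b` uniform. -/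
theorem majorizes_uniformChannel {A₀ B₀ : Type} [Fintype A₀] [Unique A₀]
    [Fintype B₀] [DecidableEq B₀] [Nonempty B₀] [Fintype A] [DecidableEq A] [Nonempty A]
    [Fintype B] [DecidableEq B] [Nonempty B] {N : Channel A B}
    (h : Real.logb 2 (Fintype.card B₀) ≤ channelMinEntropy A B N) :
    Majorizes (uniformChannel A₀ B₀) N := by
  classical
  have hcard : Fintype.card B₀ ≤ Fintype.card B := by
    have h' := h.trans (channelMinEntropy_le_logb_card N)
    rw [Real.logb_le_logb one_lt_two (Nat.cast_pos.2 Fintype.card_pos)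
      (Nat.cast_pos.2 Fintype.card_pos), Nat.cast_le] at h'
    exact h'
  obtain ⟨f⟩ := Function.Embedding.nonempty_of_card_le hcard
  obtain ⟨Φ, hΦf, hΦ⟩ := exists_channels_sum_eq_traceOne f
    ((logb_natCast_le_channelMinEntropy_iff N Fintype.card_pos).1 h)
  refine Or.inr ⟨hcard, embeddingMatrix f, isIsometry_embeddingMatrix f.injective,
    (isConditionallyUnital_measureControlled hΦ).majorizesSame
      (isCP_measureControlled fun b => (Φ b).2.1) (isTP_measureControlled fun b => (Φ b).2.2)
      fun X => ?_⟩
  have hstate : (conjBy (embeddingMatrix f) ∘ₗ (uniformChannel A₀ B₀).1) 1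
      = (Fintype.card B₀ : ℂ)⁻¹ • (embeddingMatrix f * (embeddingMatrix f)ᴴ) := by
    change conjBy (embeddingMatrix f) (uniformSuperop A₀ B₀ 1) = _
    rw [uniformSuperop_one, map_smul]
    change _ • (embeddingMatrix f * (1 : Matrix B₀ B₀ ℂ) * (embeddingMatrix f)ᴴ) = _
    rw [Matrix.mul_one]
  simp only [hstate, measureControlled_kronecker, Matrix.smul_apply, smul_assoc]
  rw [← Finset.smul_sum, sum_embeddingMatrix_mul_conjTranspose_smul f fun b => (Φ b).1 X]
  simp only [hΦf, Finset.sum_const, Finset.card_univ]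
  rw [← Nat.cast_smul_eq_nsmul ℂ, inv_smul_smul₀ (by simp)]

/-! ### Minimality -/

theorem tensor_uniformChannel [Fintype A] [Fintype B] [DecidableEq B] [Nonempty B] [Fintype A']
    [Fintype B'] [DecidableEq B'] [Nonempty B'] :
    (uniformChannel A B).tensor (uniformChannel A' B') = uniformChannel (A × A') (B × B') := by
  refine Subtype.ext (LinearMap.ext fun X => ?_)
  ext p q
  simp [Channel.tensor, uniformChannel, uniformSuperop, tensor, lTensor, rTensor, Matrix.trace,
    Fintype.sum_prod_type, Matrix.one_apply, Prod.ext_iff, ite_and, div_eq_mul_inv,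
    ← Finset.mul_sum, mul_assoc, mul_comm]

namespace IsChannelEntropy

variable {H H' : ChannelFunction} [Fintype A] [DecidableEq A] [Nonempty A] [Fintype B]
  [DecidableEq B] [Nonempty B]

theorem uniformChannel_le_uniformChannel (hH : IsChannelEntropy H) [Unique A] [Fintype A']
    [DecidableEq A'] [Nonempty A'] [Fintype B'] [DecidableEq B'] [Nonempty B']
    (hcard : Fintype.card B ≤ Fintype.card B') :
    H A B (uniformChannel A B) ≤ H A' B' (uniformChannel A' B') := by
  refine hH.monotone _ _ _ _ _ _ (majorizes_uniformChannel ?_)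
  rw [channelMinEntropy_uniformChannel]
  exact Real.logb_le_logb_of_le one_lt_two (Nat.cast_pos.2 Fintype.card_pos) (Nat.cast_le.2 hcard)

theorem uniformChannel_eq_uniformChannel (hH : IsChannelEntropy H) [Unique A] [Fintype A']
    [DecidableEq A'] [Unique A'] [Fintype B'] [DecidableEq B'] [Nonempty B']
    (hcard : Fintype.card B = Fintype.card B') :
    H A B (uniformChannel A B) = H A' B' (uniformChannel A' B') :=
  (hH.uniformChannel_le_uniformChannel hcard.le).antisymm
    (hH.uniformChannel_le_uniformChannel hcard.ge)

theorem uniformChannel_fin_two_pow (hH : IsChannelEntropy H) (hn : IsNormalized H) (n : ℕ) :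
    H Unit (Fin (2 ^ n)) (uniformChannel Unit (Fin (2 ^ n))) = n := by
  have : Unique (Unit × Unit) := Unique.mk' _
  induction n with
  | zero =>
    set u := uniformChannel Unit (Fin (2 ^ 0))
    have hu : H _ _ (u.tensor u) = H _ _ u := by
      rw [tensor_uniformChannel]
      exact hH.uniformChannel_eq_uniformChannel (by simp)
    rw [hH.additive] at hu
    rw [Nat.cast_zero]
    linarith
  | succ n ih =>
    rw [hH.uniformChannel_eq_uniformChannel (A' := Unit × Unit) (B' := Fin (2 ^ n) × Fin 2)
      (by simp [pow_succ]), ← tensor_uniformChannel, hH.additive, ih, hn, Nat.cast_succ]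

theorem natCast_le (hH : IsChannelEntropy H) (hn : IsNormalized H) {N : Channel A B} {n : ℕ}
    (h : n ≤ channelMinEntropy A B N) : n ≤ H A B N := by
  rw [← hH.uniformChannel_fin_two_pow hn]
  exact hH.monotone _ _ _ _ _ _ (majorizes_uniformChannel (by simpa [Real.logb_pow] using h))

theorem channelMinEntropy_le_add_one (hH : IsChannelEntropy H) (hn : IsNormalized H)
    (N : Channel A B) : channelMinEntropy A B N ≤ H A B N + 1 := by
  -- Adding a large uniform state makes the min-entropy nonnegative, so that it has a floor in `ℕ`.
  obtain ⟨j, hj⟩ := exists_nat_ge (-channelMinEntropy A B N)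
  set M := N.tensor (uniformChannel Unit (Fin (2 ^ j))) with hM
  have hmin : channelMinEntropy _ _ M = channelMinEntropy A B N + j := by
    rw [hM, isChannelEntropy_channelMinEntropy.additive,
      isChannelEntropy_channelMinEntropy.uniformChannel_fin_two_pow isNormalized_channelMinEntropy]
  have hHM : H _ _ M = H A B N + j := by
    rw [hM, hH.additive, hH.uniformChannel_fin_two_pow hn]
  have hpos : 0 ≤ channelMinEntropy _ _ M := by linarith
  linarith [Nat.lt_floor_add_one (channelMinEntropy _ _ M), hH.natCast_le hn (Nat.floor_le hpos)]

theorem le_of_le_add (hH : IsChannelEntropy H) (hH' : IsChannelEntropy H') {C : ℝ}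
    (h : ∀ (A B : Type) [Fintype A] [DecidableEq A] [Nonempty A] [Fintype B] [DecidableEq B]
      [Nonempty B] (N : Channel A B), H' A B N ≤ H A B N + C) (N : Channel A B) :
    H' A B N ≤ H A B N := by
  have htwo_pow : ∀ (n : ℕ) (A B : Type) [Fintype A] [DecidableEq A] [Nonempty A] [Fintype B]
      [DecidableEq B] [Nonempty B] (N : Channel A B), 2 ^ n * (H' A B N - H A B N) ≤ C := by
    intro n
    induction n with
    | zero =>
      intro A B _ _ _ _ _ _ N
      linarith [h A B N]
    | succ n ih =>
      intro A B _ _ _ _ _ _ N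
      have hNN := ih _ _ (N.tensor N)
      rw [hH.additive, hH'.additive] at hNN
      rw [pow_succ]
      linarith
  by_contra! hlt
  obtain ⟨n, hC⟩ := pow_unbounded_of_one_lt (C / (H' A B N - H A B N)) one_lt_two
  rw [div_lt_iff₀ (sub_pos.2 hlt)] at hC
  exact hC.not_ge (htwo_pow n A B N)

theorem channelMinEntropy_le (hH : IsChannelEntropy H) (hn : IsNormalized H) (N : Channel A B) :
    channelMinEntropy A B N ≤ H A B N :=
  hH.le_of_le_add isChannelEntropy_channelMinEntropy
    (fun _ _ _ _ _ _ _ _ => hH.channelMinEntropy_le_add_one hn) N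

end IsChannelEntropy

end QChannel

end

theorem theorem18 :
    (QChannel.IsChannelEntropy QChannel.channelMinEntropy ∧
      QChannel.IsNormalized QChannel.channelMinEntropy) ∧
    ∀ H : QChannel.ChannelFunction, QChannel.IsChannelEntropy H → QChannel.IsNormalized H →
      ∀ (A B : Type) [Fintype A] [DecidableEq A] [Nonempty A]
        [Fintype B] [DecidableEq B] [Nonempty B] (N : QChannel.Channel A B),
        QChannel.channelMinEntropy A B N ≤ H A B N :=
  ⟨⟨QChannel.isChannelEntropy_channelMinEntropy, QChannel.isNormalized_channelMinEntropy⟩,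
    fun _ hH hn _ _ _ _ _ _ _ _ N => hH.channelMinEntropy_le hn N⟩
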